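/- Let $n$ servers be given, and let $U_1,U_2,U_3,\dots$ be any sequence, fixed in advance, of sets of servers (the useful servers of rounds $1,2,3,\dots$) with $n/4\le |U_t|\le n$ for all $t\ge 1$. Let $K$ be a totally ordered set, and let the servers start with arbitrary values from $K$. Apply the $(3,3)$-median rule repeatedly: in each round $t\ge 1$, every server chooses three servers independently and uniformly at random (with repetition) from $U_t$, independently of all other servers and rounds, and its value in round $t+1$ is the median of the three values that the chosen servers hold in round $t$. (So the values of the servers in $U_{t+1}$ are obtained from those of the servers in $U_t$; values held in round $t$ by servers outside $U_t$ are never used.) Then agreement is reached in $O(\log n)$ rounds with high probability. That is, for every constant $c>0$ there are constants $C$ and $n_0$, depending only on $c$, such that for all $n\ge n_0$, all totally ordered sets $K$, all sequences $(U_t)_{t\ge1}$ as above and all initial values, with probability at least $1-n^{-c}$ there is one value $v\in K$ such that, in every round that begins after at least $C\ln n$ rounds have been executed, all useful servers of that round hold the value $v$. -/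

import Mathlib

open MeasureTheory ProbabilityTheory

/-- The median of three values: the middle entry once they are sorted increasingly. -/
def median3 {K : Type*} [LinearOrder K] (v : Fin 3 → K) : K :=
  v (Tuple.sort v 1)

/-- The random choices of one round: `r i j` is the server addressed by the `j`-th of the three
value requests of server `i`. The `n` servers are numbered by `Fin n`. -/
abbrev Requests (n : ℕ) : Type := Fin n → Fin 3 → Fin n

/-- The random choices of one round in which the `(3,3)`-median rule is applied to the set `A`:
all the requests of all the servers are independent and uniformly distributed on `A`. -/
noncomputable def roundMeasure {n : ℕ} (A : Finset (Fin n)) : Measure (Requests n) :=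
  Measure.pi fun _ : Fin n => Measure.pi fun _ : Fin 3 => uniformOn (A : Set (Fin n))

/-- The random choices of all rounds: the rounds are independent, and in round `t` the
`(3,3)`-median rule is applied to `U t`. -/
noncomputable def executionMeasure {n : ℕ} (U : ℕ → Finset (Fin n)) :
    Measure (ℕ → Requests n) :=
  Measure.infinitePi fun t => roundMeasure (U t)

/-- `values x₀ ω t i` is the value of server `i` at the beginning of round `t`, when the initial
values are `x₀` and the random choices are `ω`. In round `t` each server replaces its value by the
median of the three values that it receives. As all requests of round `t` go to `U t`, the values
in round `t` of servers outside `U t` are never used. -/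
def values {n : ℕ} {K : Type*} [LinearOrder K] (x₀ : Fin n → K) (ω : ℕ → Requests n) :
    ℕ → Fin n → K
  | 0 => x₀
  | t + 1 => fun i => median3 fun j => values x₀ ω t (ω t i j)

/-- Agreement within `τ` rounds: there is one value that is held by all useful servers in every
round `t ≥ τ`. -/
def AgreementWithin {n : ℕ} {K : Type*} [LinearOrder K] (U : ℕ → Finset (Fin n))
    (x₀ : Fin n → K) (τ : ℝ) (ω : ℕ → Requests n) : Prop :=
  ∃ v : K, ∀ t : ℕ, τ ≤ (t : ℝ) → ∀ i ∈ U t, values x₀ ω t i = v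

/-!
The `(3,3)`-median rule commutes with monotone maps, so for every initial value `v` the bits
`v < value` of the servers follow the `(3,3)`-median rule on `Bool`, that is, the majority rule
(`values_comp_monotone`, `toNat_median3`). All values are initial values, hence if all these binary
executions are unanimous on the useful servers then so are the values themselves
(`exists_threshold_of_not_agreement`), and agreement once reached persists
(`values_eq_of_unanimous`). There are at most `n` thresholds `v`, so by a union bound it is enough
that every binary execution fails to be unanimous with probability at most `n ^ (-(c + 1))`.

For a binary execution let `p` be the fraction of useful servers with bit `true`. After the round,
`p` has become an average of `m ≥ n / 4` independent bits of mean `q = 3 p² - 2 p³`. The potential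
`p (1 - p) / ((p - 1 / 2)² + b)` with `b = 160 / n` is a Lyapunov function: its expectation decreases
by a constant factor in every round (`integral_potential_medianStep_le`). Away from a tie this is
the drift of the majority rule, against which the noise is negligible, as its variance
`q (1 - q) / m` is small compared with `b` and vanishes together with the minority
(`integral_potential_le_of_variance`). Near a tie the gain comes from the noise itself, which drives
`p` away from `1 / 2` by an amount comparable with `√b` (`integral_potential_le_of_near_half`).

The potential is at most `n` in the beginning and at least `1 / n ^ 2` unless the useful servers are
unanimous, so Markov's inequality shows that after `t` rounds unanimity fails with probability at
most `ρ ^ t n ^ 3` for a constant `ρ < 1` (`measure_not_unanimous_le`). This is as small as required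
for `t` a large multiple of `log n`.
-/

/-! ### The potential and its behaviour without noise -/

/-- The potential of a fraction `p` of servers that are in one of two states. It vanishes at
unanimity, `p ∈ {0, 1}`, and is largest at the tie `p = 1 / 2`, where `b` keeps it finite; with
`b = 160 / n` the regularisation acts at distances `|p - 1 / 2|` of order `n ^ (-1 / 2)`, the scale
of the random fluctuations of one round. -/
noncomputable def potential (b p : ℝ) : ℝ := p * (1 - p) / ((p - 1 / 2) ^ 2 + b)

/-- The probability that at least two of three independent events of probability `p` occur. -/
def majorityProb (p : ℝ) : ℝ := 3 * p ^ 2 - 2 * p ^ 3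

theorem potential_eq {b : ℝ} (hb : 0 < b) (p : ℝ) :
    potential b p = (1 / 4 + b) / ((p - 1 / 2) ^ 2 + b) - 1 := by
  have : (p - 1 / 2) ^ 2 + b ≠ 0 := by positivity
  unfold potential
  field_simp
  ring

/-- The tangent of `y ↦ 1 / (y ^ 2 + b)` at `μ`, corrected by the smallest quadratic term that makes
it an upper bound on the whole line. -/
theorem one_div_sq_add_le {b : ℝ} (hb : 0 < b) (μ y : ℝ) :
    1 / (y ^ 2 + b) ≤ 1 / (μ ^ 2 + b) - 2 * μ / (μ ^ 2 + b) ^ 2 * (y - μ)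
      + μ ^ 2 / b / (μ ^ 2 + b) ^ 2 * (y - μ) ^ 2 := by
  have hy : 0 < y ^ 2 + b := by positivity
  have hB : 0 < μ ^ 2 + b := by positivity
  have key : 1 / (μ ^ 2 + b) - 2 * μ / (μ ^ 2 + b) ^ 2 * (y - μ)
      + μ ^ 2 / b / (μ ^ 2 + b) ^ 2 * (y - μ) ^ 2 - 1 / (y ^ 2 + b)
      = (y - μ) ^ 2 * (μ * y - b) ^ 2 / (b * (μ ^ 2 + b) ^ 2 * (y ^ 2 + b)) := by
    field_simp
    ring
  have : 0 ≤ (y - μ) ^ 2 * (μ * y - b) ^ 2 / (b * (μ ^ 2 + b) ^ 2 * (y ^ 2 + b)) := by positivity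
  linarith

theorem one_div_sq_add_le_quartic {b : ℝ} (hb : 0 < b) (y : ℝ) :
    1 / (y ^ 2 + b) ≤ 1 / b * (1 - y ^ 2 / b + y ^ 4 / b ^ 2) := by
  have hy : 0 < y ^ 2 + b := by positivity
  have key : 1 / b * (1 - y ^ 2 / b + y ^ 4 / b ^ 2) - 1 / (y ^ 2 + b)
      = y ^ 6 / (b ^ 3 * (y ^ 2 + b)) := by
    field_simp
    ring
  have : 0 ≤ y ^ 6 / (b ^ 3 * (y ^ 2 + b)) := by positivity
  linarith

theorem potential_nonneg {b p : ℝ} (hb : 0 < b) (h0 : 0 ≤ p) (h1 : p ≤ 1) : 0 ≤ potential b p :=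
  div_nonneg (mul_nonneg h0 (by linarith)) (by positivity)

/-- One round without noise: the potential contracts, the more so the farther the majority is
from a tie. -/
theorem potential_majorityProb_le {b p : ℝ} (hb : 0 < b) (h0 : 0 ≤ p) (h1 : p ≤ 1) :
    potential b (majorityProb p) ≤
      (1 - 5 / 9 * ((majorityProb p - 1 / 2) ^ 2 / ((majorityProb p - 1 / 2) ^ 2 + b)))
        * potential b p := by
  -- Both sides are functions of `x`, since `1 / 4 - x` is the squared distance from a tie.
  set x := p * (1 - p) with hx
  have hx0 : 0 ≤ x := mul_nonneg h0 (by linarith)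
  have hu : (p - 1 / 2) ^ 2 = 1 / 4 - x := by rw [hx]; ring
  have hx4 : x ≤ 1 / 4 := by nlinarith [sq_nonneg (p - 1 / 2)]
  have hq : majorityProb p * (1 - majorityProb p) = x * (x * (3 + 4 * x)) := by
    rw [hx, majorityProb]; ring
  have hz : (majorityProb p - 1 / 2) ^ 2 = (1 / 4 - x) * (1 + 2 * x) ^ 2 := by
    rw [hx, majorityProb]; ring
  unfold potential
  rw [hq, hz, hu, ← hx]
  set z := (1 / 4 - x) * (1 + 2 * x) ^ 2 with hzd
  have hz0 : 0 ≤ z := mul_nonneg (by linarith) (by positivity)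
  have hB : 0 < z + b := by positivity
  have hu0 : 0 < 1 / 4 - x + b := by linarith
  have e : (1 - 5 / 9 * (z / (z + b))) * (x / (1 / 4 - x + b)) =
      x * (4 / 9 * z + b) / ((z + b) * (1 / 4 - x + b)) := by
    field_simp
    ring
  rw [e, div_le_div_iff₀ hB (by positivity)]
  have h3 : x * (3 + 4 * x) * (1 / 4 - x + b) ≤ 4 / 9 * z + b := by
    have ha : x * (3 + 4 * x) ≤ 1 := by nlinarith
    have hc : x * (3 + 4 * x) ≤ 4 / 9 * (1 + 2 * x) ^ 2 := by nlinarith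
    have := mul_le_mul_of_nonneg_right hc (by linarith : 0 ≤ 1 / 4 - x)
    have := mul_le_mul_of_nonneg_right ha hb.le
    rw [hzd]
    linarith
  have := mul_le_mul_of_nonneg_left h3 (mul_nonneg hx0 hB.le)
  linarith

/-! ### The potential under centred noise -/

section drift

variable {Ω : Type*} [MeasurableSpace Ω] {P : Measure Ω} [IsProbabilityMeasure P]

/-- One round with noise, away from a tie. The variance `q * (1 - q) / m` of the noise vanishes with
the minority, so the second order loss is a small multiple of the potential, and it is smaller
than the gain in `potential_majorityProb_le`. -/
theorem integral_potential_le_of_variance {ξ : Ω → ℝ} {b p : ℝ} (hb : 0 < b)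
    (hb4 : b ≤ 1 / 4) (h0 : 0 ≤ p) (h1 : p ≤ 1)
    (i0 : Integrable (fun ω => potential b (majorityProb p + ξ ω)) P)
    (i1 : Integrable ξ P) (i2 : Integrable (fun ω => ξ ω ^ 2) P)
    (e1 : ∫ ω, ξ ω ∂P = 0)
    (e2 : ∫ ω, ξ ω ^ 2 ∂P ≤ majorityProb p * (1 - majorityProb p) * (b / 9)) :
    ∫ ω, potential b (majorityProb p + ξ ω) ∂P ≤
      (1 - 1 / 2 * ((majorityProb p - 1 / 2) ^ 2 / ((majorityProb p - 1 / 2) ^ 2 + b)))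
        * potential b p := by
  have hmf := potential_majorityProb_le hb h0 h1
  have hq0 : 0 ≤ majorityProb p := by unfold majorityProb; nlinarith [sq_nonneg p]
  have hq1 : majorityProb p ≤ 1 := by
    unfold majorityProb; nlinarith [mul_nonneg (sq_nonneg (1 - p)) (by linarith : 0 ≤ 1 + 2 * p)]
  set q := majorityProb p with hq
  have hpot : potential b q = q * (1 - q) / ((q - 1 / 2) ^ 2 + b) := rfl
  have hpn := potential_nonneg hb hq0 hq1
  set μ := q - 1 / 2 with hμ
  have hB : 0 < μ ^ 2 + b := by positivity
  set θ := μ ^ 2 / (μ ^ 2 + b) with hθ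
  have hθ0 : 0 ≤ θ := by positivity
  have hpw : ∀ ω, potential b (q + ξ ω) ≤ potential b q
      + (-((1 / 4 + b) * (2 * μ / (μ ^ 2 + b) ^ 2)) * ξ ω
      + (1 / 4 + b) * (μ ^ 2 / b / (μ ^ 2 + b) ^ 2) * ξ ω ^ 2) := by
    intro ω
    have := mul_le_mul_of_nonneg_left (one_div_sq_add_le hb μ (μ + ξ ω))
      (by linarith : 0 ≤ 1 / 4 + b)
    rw [potential_eq hb, potential_eq hb, show q + ξ ω - 1 / 2 = μ + ξ ω by rw [hμ]; ring,
      div_eq_mul_one_div (1 / 4 + b), ← hμ, div_eq_mul_one_div (1 / 4 + b) (μ ^ 2 + b)]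
    rw [show μ + ξ ω - μ = ξ ω by ring] at this
    linarith
  have hint := integral_mono i0 ((integrable_const _).add
    ((i1.const_mul _).add (i2.const_mul _))) hpw
  rw [integral_add' (integrable_const _) ((i1.const_mul _).add (i2.const_mul _)),
    integral_add' (i1.const_mul _) (i2.const_mul _), integral_const_mul, integral_const_mul, e1,
    integral_const] at hint
  simp only [probReal_univ, one_smul, mul_zero, zero_add] at hint
  -- The smallness of `ξ` enters here: its second moment carries the factor `q * (1 - q)`, the
  -- numerator of the potential at `q`.
  have hloss : (1 / 4 + b) * (μ ^ 2 / b / (μ ^ 2 + b) ^ 2) * ∫ ω, ξ ω ^ 2 ∂P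
      ≤ 1 / 18 * θ * potential b q := by
    calc _ ≤ (1 / 4 + b) * (μ ^ 2 / b / (μ ^ 2 + b) ^ 2) * (q * (1 - q) * (b / 9)) :=
          mul_le_mul_of_nonneg_left e2 (by positivity)
      _ = (1 / 4 + b) * (1 / 9) * (θ * potential b q) := by
          rw [hpot, hθ]; field_simp
      _ ≤ 1 / 2 * (1 / 9) * (θ * potential b q) := by gcongr; linarith
      _ = _ := by ring
  have h2 : (1 + 1 / 18 * θ) * potential b q
      ≤ (1 + 1 / 18 * θ) * ((1 - 5 / 9 * θ) * potential b p) :=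
    mul_le_mul_of_nonneg_left hmf (by positivity)
  have hpp := potential_nonneg hb h0 h1
  nlinarith [mul_nonneg (mul_nonneg hθ0 hθ0) hpp]

/-- One round with noise, near a tie. There the mean barely moves, and it is the noise that pushes
the fraction away from `1 / 2`: the gain is the second moment of the noise, and the fourth moment
controls the error. -/
theorem integral_potential_le_of_near_half {ξ : Ω → ℝ} {b p r : ℝ} (hb : 0 < b)
    (hb4 : b ≤ 1 / 4) (h0 : 0 ≤ p) (h1 : p ≤ 1)
    (hr : 1 / 160 ≤ r) (hr' : r ≤ 1 / 40)
    (hnear : (majorityProb p - 1 / 2) ^ 2 ≤ b / 3200)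
    (i0 : Integrable (fun ω => potential b (majorityProb p + ξ ω)) P)
    (i1 : Integrable ξ P) (i2 : Integrable (fun ω => ξ ω ^ 2) P)
    (i4 : Integrable (fun ω => ξ ω ^ 4) P)
    (e1 : ∫ ω, ξ ω ∂P = 0)
    (e2 : majorityProb p * (1 - majorityProb p) * (b * r) ≤ ∫ ω, ξ ω ^ 2 ∂P)
    (e4 : ∫ ω, ξ ω ^ 4 ∂P ≤ (b * r) ^ 2 / 2) :
    ∫ ω, potential b (majorityProb p + ξ ω) ∂P ≤ (1 - 1 / 3200) * potential b p := by
  have hu : (p - 1 / 2) ^ 2 ≤ (majorityProb p - 1 / 2) ^ 2 := by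
    have : (majorityProb p - 1 / 2) ^ 2 = (p - 1 / 2) ^ 2 * (1 + 2 * (p * (1 - p))) ^ 2 := by
      unfold majorityProb; ring
    rw [this]
    have h3 : 0 ≤ p * (1 - p) := mul_nonneg h0 (by linarith)
    exact le_mul_of_one_le_right (sq_nonneg _) (one_le_pow₀ (by linarith))
  set q := majorityProb p with hq
  have hq4 : q * (1 - q) = 1 / 4 - (q - 1 / 2) ^ 2 := by ring
  rw [hq4] at e2
  set μ := q - 1 / 2 with hμ
  set A := (1 / 4 + b) / b with hA
  have hA0 : 0 < A := by positivity
  have hpw : ∀ ω, potential b (q + ξ ω) ≤ (A * (1 - μ ^ 2 / b + 8 * μ ^ 4 / b ^ 2) - 1)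
      + (-(A * (2 * μ / b)) * ξ ω + (-(A / b) * ξ ω ^ 2 + A * (8 / b ^ 2) * ξ ω ^ 4)) := by
    intro ω
    have h4 : (μ + ξ ω) ^ 4 ≤ 8 * μ ^ 4 + 8 * ξ ω ^ 4 := by
      have := Even.add_pow_le (n := 4) (by decide) (a := μ) (b := ξ ω)
      norm_num at this
      linarith
    have h5 := one_div_sq_add_le_quartic hb (μ + ξ ω)
    have h6 := mul_le_mul_of_nonneg_left h5 (by linarith : 0 ≤ 1 / 4 + b)
    have h7 : (μ + ξ ω) ^ 4 / b ^ 2 ≤ (8 * μ ^ 4 + 8 * ξ ω ^ 4) / b ^ 2 := by gcongr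
    have h8 := mul_le_mul_of_nonneg_left h7 hA0.le
    rw [potential_eq hb, show q + ξ ω - 1 / 2 = μ + ξ ω by rw [hμ]; ring,
      div_eq_mul_one_div (1 / 4 + b)]
    have e : (1 / 4 + b) * (1 / b * (1 - (μ + ξ ω) ^ 2 / b + (μ + ξ ω) ^ 4 / b ^ 2))
      = A * (1 - (μ + ξ ω) ^ 2 / b) + A * ((μ + ξ ω) ^ 4 / b ^ 2) := by rw [hA]; ring
    rw [e] at h6
    have e' : A * (1 - (μ + ξ ω) ^ 2 / b) + A * ((8 * μ ^ 4 + 8 * ξ ω ^ 4) / b ^ 2) - 1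
      = (A * (1 - μ ^ 2 / b + 8 * μ ^ 4 / b ^ 2) - 1)
      + (-(A * (2 * μ / b)) * ξ ω + (-(A / b) * ξ ω ^ 2 + A * (8 / b ^ 2) * ξ ω ^ 4)) := by
      ring
    linarith
  have hint := integral_mono i0 ((integrable_const _).add
    ((i1.const_mul _).add ((i2.const_mul _).add (i4.const_mul _)))) hpw
  rw [integral_add' (integrable_const _)
      ((i1.const_mul _).add ((i2.const_mul _).add (i4.const_mul _))),
    integral_add' (i1.const_mul _) ((i2.const_mul _).add (i4.const_mul _)),
    integral_add' (i2.const_mul _) (i4.const_mul _), integral_const_mul, integral_const_mul,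
    integral_const_mul, e1, integral_const] at hint
  simp only [probReal_univ, one_smul, mul_zero, zero_add] at hint
  set w := μ ^ 2 / b with hw
  have hw0 : 0 ≤ w := by positivity
  have hw1 : w ≤ 1 / 3200 := by rw [hw, div_le_iff₀ hb]; linarith
  have g2 : (1 / 5) * r ≤ (∫ ω, ξ ω ^ 2 ∂P) / b := by
    rw [le_div_iff₀ hb]
    refine le_trans ?_ e2
    have hbr : 0 ≤ b * r := by positivity
    have := mul_le_mul_of_nonneg_right (by linarith : 1 / 5 ≤ 1 / 4 - μ ^ 2) hbr
    linarith
  have g4 : (∫ ω, ξ ω ^ 4 ∂P) / b ^ 2 ≤ r ^ 2 / 2 := by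
    rw [div_le_iff₀ (by positivity)]
    linarith
  have g8 : 8 * μ ^ 4 / b ^ 2 = 8 * w ^ 2 := by rw [hw]; ring
  rw [g8] at hint
  have hsum : ∫ ω, potential b (q + ξ ω) ∂P ≤ A * (1 - 1 / 1600) - 1 := by
    have e : A * (1 - w + 8 * w ^ 2) - 1 + (-(A / b) * ∫ ω, ξ ω ^ 2 ∂P)
        + A * (8 / b ^ 2) * ∫ ω, ξ ω ^ 4 ∂P = A * (1 - w + 8 * w ^ 2
        - (∫ ω, ξ ω ^ 2 ∂P) / b + 8 * ((∫ ω, ξ ω ^ 4 ∂P) / b ^ 2)) - 1 := by ring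
    have : 1 - w + 8 * w ^ 2 - (∫ ω, ξ ω ^ 2 ∂P) / b + 8 * ((∫ ω, ξ ω ^ 4 ∂P) / b ^ 2)
        ≤ 1 - 1 / 1600 := by
      have hw2 : 8 * w ^ 2 ≤ w := by nlinarith
      have hr2 : 4 * r ^ 2 ≤ r / 10 := by nlinarith
      linarith
    have := mul_le_mul_of_nonneg_left this hA0.le
    linarith
  have hp : A * (1 - 1 / 3200) - 1 ≤ potential b p := by
    rw [potential_eq hb]
    have : A * (1 - 1 / 3200) ≤ (1 / 4 + b) / ((p - 1 / 2) ^ 2 + b) := by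
      rw [hA, div_mul_eq_mul_div, div_le_div_iff₀ hb (by positivity)]
      have : (1 - 1 / 3200) * ((p - 1 / 2) ^ 2 + b) ≤ b := by linarith
      have := mul_le_mul_of_nonneg_left this (by linarith : 0 ≤ 1 / 4 + b)
      linarith
    linarith
  linarith

end drift

/-! ### Moments of sums of independent random variables -/

section moments

variable {Ω ι : Type*} [MeasurableSpace Ω] {P : Measure Ω}

theorem integral_pow_mul_pow_of_indepFun {X Z : Ω → ℝ} (h : IndepFun X Z P) (hX : Measurable X)
    (hZ : Measurable Z) (j k : ℕ) :
    ∫ ω, X ω ^ j * Z ω ^ k ∂P = (∫ ω, X ω ^ j ∂P) * ∫ ω, Z ω ^ k ∂P :=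
  (h.comp (measurable_id.pow_const j) (measurable_id.pow_const k)).integral_mul_eq_mul_integral
    (hX.pow_const j).aestronglyMeasurable (hZ.pow_const k).aestronglyMeasurable

variable [IsProbabilityMeasure P]

theorem integrable_pow_of_abs_le {Z : Ω → ℝ} (hZ : Measurable Z) {C : ℝ}
    (hC : ∀ ω, |Z ω| ≤ C) (k : ℕ) : Integrable (fun ω => Z ω ^ k) P :=
  .of_bound (hZ.pow_const k).aestronglyMeasurable (C ^ k) (.of_forall fun ω => by
    rw [norm_pow, Real.norm_eq_abs]
    exact pow_le_pow_left₀ (abs_nonneg _) (hC ω) k)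

/-- Moments of sums of independent centred random variables, all of variance `v`, that are bounded
by `1`; the bound makes their fourth moments at most `v`. -/
theorem moments_sum_of_iIndepFun {Y : ι → Ω → ℝ} (hI : iIndepFun Y P)
    (hm : ∀ i, Measurable (Y i)) (hb : ∀ i ω, |Y i ω| ≤ 1) {v : ℝ}
    (h1 : ∀ i, ∫ ω, Y i ω ∂P = 0) (h2 : ∀ i, ∫ ω, Y i ω ^ 2 ∂P = v) (s : Finset ι) :
    ∫ ω, ∑ i ∈ s, Y i ω ∂P = 0 ∧ ∫ ω, (∑ i ∈ s, Y i ω) ^ 2 ∂P = s.card * v ∧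
      ∫ ω, (∑ i ∈ s, Y i ω) ^ 4 ∂P ≤ 3 * s.card ^ 2 * v ^ 2 + s.card * v := by
  classical
  induction s using Finset.induction_on with
  | empty => simp
  | insert i s hi ih =>
    obtain ⟨a1, a2, a4⟩ := ih
    set S : Ω → ℝ := fun ω => ∑ j ∈ s, Y j ω with hS
    replace a2 : ∫ ω, S ω ^ 2 ∂P = s.card * v := a2
    replace a4 : ∫ ω, S ω ^ 4 ∂P ≤ 3 * s.card ^ 2 * v ^ 2 + s.card * v := a4
    have hSm : Measurable S := Finset.measurable_fun_sum s fun j _ => hm j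
    have hSb : ∀ ω, |S ω| ≤ s.card := fun ω =>
      (Finset.abs_sum_le_sum_abs _ _).trans
        ((Finset.sum_le_sum fun j _ => hb j ω).trans (by simp))
    have hind : IndepFun S (Y i) P := by
      convert hI.indepFun_finsetSum_of_notMem hm hi using 1
      ext ω
      simp [hS]
    have hmul := integral_pow_mul_pow_of_indepFun hind hSm (hm i)
    have iS := integrable_pow_of_abs_le (P := P) hSm hSb
    have iY := integrable_pow_of_abs_le (P := P) (hm i) (hb i)
    have iM : ∀ j k, Integrable (fun ω => S ω ^ j * Y i ω ^ k) P := fun j k =>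
      (hind.comp (measurable_id.pow_const j) (measurable_id.pow_const k)).integrable_mul
        (iS j) (iY k)
    have iS1 : Integrable S P := by simpa using iS 1
    have iY1 : Integrable (Y i) P := by simpa using iY 1
    have y4 : ∫ ω, Y i ω ^ 4 ∂P ≤ v := by
      rw [← h2 i]
      refine integral_mono (iY 4) (iY 2) fun ω => ?_
      have : Y i ω ^ 2 ≤ 1 := (sq_le_one_iff_abs_le_one _).mpr (hb i ω)
      nlinarith [sq_nonneg (Y i ω)]
    have hv : 0 ≤ v := by rw [← h2 i]; exact integral_nonneg fun ω => sq_nonneg _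
    simp_rw [Finset.sum_insert hi, Finset.card_insert_of_notMem hi]
    change ∫ ω, Y i ω + S ω ∂P = 0 ∧ ∫ ω, (Y i ω + S ω) ^ 2 ∂P = _ ∧ ∫ ω, (Y i ω + S ω) ^ 4 ∂P ≤ _
    have m11 := hmul 1 1
    have m31 := hmul 3 1
    have m22 := hmul 2 2
    have m13 := hmul 1 3
    simp only [pow_one, a1, h1 i, h2 i, mul_zero, zero_mul] at m11 m31 m22 m13
    refine ⟨?_, ?_, ?_⟩
    · rw [integral_add iY1 iS1, a1, h1, add_zero]
    · have e : ∀ ω, (Y i ω + S ω) ^ 2 = Y i ω ^ 2 + (2 * (S ω ^ 1 * Y i ω ^ 1) + S ω ^ 2) :=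
        fun ω => by ring
      simp_rw [e]
      have j : Integrable (fun ω => 2 * (S ω ^ 1 * Y i ω ^ 1) + S ω ^ 2) P :=
        ((iM 1 1).const_mul 2).add (iS 2)
      rw [integral_add (iY 2) j,
        integral_add ((iM 1 1).const_mul 2) (iS 2), integral_const_mul]
      simp only [pow_one, m11, h2 i, a2]
      push_cast
      ring
    · have e : ∀ ω, (Y i ω + S ω) ^ 4 = S ω ^ 4 + (4 * (S ω ^ 3 * Y i ω ^ 1)
          + (6 * (S ω ^ 2 * Y i ω ^ 2) + (4 * (S ω ^ 1 * Y i ω ^ 3) + Y i ω ^ 4))) :=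
        fun ω => by ring
      simp_rw [e]
      have j₁ : Integrable (fun ω => 4 * (S ω ^ 1 * Y i ω ^ 3) + Y i ω ^ 4) P :=
        ((iM 1 3).const_mul 4).add (iY 4)
      have j₂ : Integrable (fun ω => 6 * (S ω ^ 2 * Y i ω ^ 2)
          + (4 * (S ω ^ 1 * Y i ω ^ 3) + Y i ω ^ 4)) P := ((iM 2 2).const_mul 6).add j₁
      have j₃ : Integrable (fun ω => 4 * (S ω ^ 3 * Y i ω ^ 1) + (6 * (S ω ^ 2 * Y i ω ^ 2)
          + (4 * (S ω ^ 1 * Y i ω ^ 3) + Y i ω ^ 4))) P := ((iM 3 1).const_mul 4).add j₂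
      rw [integral_add (iS 4) j₃, integral_add ((iM 3 1).const_mul 4) j₂,
        integral_add ((iM 2 2).const_mul 6) j₁,
        integral_add ((iM 1 3).const_mul 4) (iY 4), integral_const_mul, integral_const_mul,
        integral_const_mul]
      simp only [pow_one, m31, m22, m13, a2]
      push_cast
      nlinarith [sq_nonneg v]

end moments

/-! ### One round of the binary median rule -/

section round

variable {n : ℕ}

/-- The `(3,3)`-median rule on binary values: the values after a round with requests `r`. -/
def medianStep (s : Fin n → Bool) (r : Requests n) : Fin n → Bool :=
  fun i => median3 fun j => s (r i j)

/-- The median of three binary values is their majority. -/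
theorem toNat_median3 (w : Fin 3 → Bool) : (median3 w).toNat =
    ((w 0 && w 1) || (w 0 && w 2) || (w 1 && w 2)).toNat := by
  have h : ∀ σ : Equiv.Perm (Fin 3), ∀ w : Fin 3 → Bool, w (σ 0) ≤ w (σ 1) → w (σ 1) ≤ w (σ 2) →
      (w (σ 1)).toNat = ((w 0 && w 1) || (w 0 && w 2) || (w 1 && w 2)).toNat := by decide
  have hmono := Tuple.monotone_sort w
  exact h (Tuple.sort w) w (hmono (by decide)) (hmono (by decide))

/-- The fraction of the members of `A` with value `true` (`0` if `A` is empty). -/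
noncomputable def fraction (A : Finset (Fin n)) (s : Fin n → Bool) : ℝ :=
  (∑ i ∈ A, ((s i).toNat : ℝ)) / A.card

theorem fraction_nonneg (A : Finset (Fin n)) (s : Fin n → Bool) : 0 ≤ fraction A s :=
  div_nonneg (Finset.sum_nonneg fun _ _ => Nat.cast_nonneg _) (Nat.cast_nonneg _)

theorem fraction_le_one (A : Finset (Fin n)) (s : Fin n → Bool) : fraction A s ≤ 1 := by
  refine div_le_one_of_le₀ ?_ (Nat.cast_nonneg _)
  calc ∑ i ∈ A, ((s i).toNat : ℝ) ≤ ∑ i ∈ A, (1 : ℝ) :=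
        Finset.sum_le_sum fun i _ => by exact_mod_cast Bool.toNat_le (s i)
    _ = A.card := by simp

theorem integral_uniformOn (A : Finset (Fin n)) (hA : A.Nonempty) (f : Fin n → ℝ) :
    ∫ i, f i ∂(uniformOn (A : Set (Fin n))) = (∑ i ∈ A, f i) / A.card := by
  have : IsProbabilityMeasure (uniformOn (A : Set (Fin n))) :=
    isProbabilityMeasure_uniformOn A.finite_toSet hA
  have h : ∀ i : Fin n, (uniformOn (A : Set (Fin n))).real {i}
      = if i ∈ A then (A.card : ℝ)⁻¹ else 0 := by
    intro i
    rw [Measure.real, ← Finset.coe_singleton, uniformOn_apply_finset]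
    by_cases hi : i ∈ A <;> simp [hi]
  rw [integral_fintype .of_finite]
  simp_rw [h, smul_eq_mul, ite_mul, zero_mul]
  rw [Finset.sum_ite_mem, Finset.univ_inter, Finset.sum_div]
  exact Finset.sum_congr rfl fun i _ => by ring

instance isProbabilityMeasure_uniformOn_finset (A : Finset (Fin n)) [h : Nonempty A] :
    IsProbabilityMeasure (uniformOn (A : Set (Fin n))) :=
  isProbabilityMeasure_uniformOn A.finite_toSet (Finset.nonempty_coe_sort.mp h)

instance isProbabilityMeasure_roundMeasure (A : Finset (Fin n)) [Nonempty A] :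
    IsProbabilityMeasure (roundMeasure A) := by
  unfold roundMeasure; infer_instance

theorem integral_median3 (A : Finset (Fin n)) [Nonempty A] (s : Fin n → Bool) :
    ∫ r, ((median3 fun j => s (r j)).toNat : ℝ)
      ∂(Measure.pi fun _ : Fin 3 => uniformOn (A : Set (Fin n)))
      = majorityProb (fraction A s) := by
  have hA : A.Nonempty := Finset.nonempty_coe_sort.mp ‹_›
  set ν := Measure.pi fun _ : Fin 3 => uniformOn (A : Set (Fin n)) with hν
  set f : Fin n → ℝ := fun i => ((s i).toNat : ℝ) with hf
  have hp : ∀ g : Fin 3 → Fin n → ℝ, ∫ r, ∏ j, g j (r j) ∂ν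
      = ∏ j, ∫ i, g j i ∂(uniformOn (A : Set (Fin n))) :=
    fun g => integral_fintype_prod_eq_prod g
  have hfr : ∫ i, f i ∂(uniformOn (A : Set (Fin n))) = fraction A s := integral_uniformOn A hA f
  have h01 := hp ![f, f, fun _ => 1]
  have h02 := hp ![f, fun _ => 1, f]
  have h12 := hp ![fun _ => 1, f, f]
  have h012 := hp ![f, f, f]
  simp only [Fin.prod_univ_three, Matrix.cons_val_zero, Matrix.cons_val_one, Matrix.cons_val,
    hfr, integral_const, probReal_univ, smul_eq_mul, mul_one, one_mul] at h01 h02 h12 h012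
  -- The majority of three bits as a multilinear polynomial, whose integral factorises.
  have e : ∀ r : Fin 3 → Fin n, ((median3 fun j => s (r j)).toNat : ℝ)
      = (f (r 0) * f (r 1) + f (r 0) * f (r 2)) + (f (r 1) * f (r 2)
        - 2 * (f (r 0) * f (r 1) * f (r 2))) := by
    intro r
    simp only [hf, toNat_median3]
    cases s (r 0) <;> cases s (r 1) <;> cases s (r 2) <;> norm_num
  simp_rw [e]
  rw [integral_add .of_finite .of_finite, integral_add .of_finite .of_finite,
    integral_sub .of_finite .of_finite, integral_const_mul, h01, h02, h12, h012, majorityProb]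
  ring

/-- One round of the `(3,3)`-median rule on binary values, applied to `A`, multiplies the expected
potential by a constant less than `1`, when the potential is afterwards evaluated on `A'`. -/
theorem integral_potential_medianStep_le (hn : 640 ≤ n) (A A' : Finset (Fin n)) [Nonempty A]
    (hA' : (n : ℝ) / 4 ≤ A'.card) (s : Fin n → Bool) :
    ∫ r, potential (160 / n) (fraction A' (medianStep s r)) ∂(roundMeasure A)
      ≤ (1 - 1 / 12804) * potential (160 / n) (fraction A s) := by
  have hn' : (640 : ℝ) ≤ n := by exact_mod_cast hn
  have hnpos : (0 : ℝ) < n := by linarith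
  have hm0 : (0 : ℝ) < A'.card := by linarith
  have hmn : (A'.card : ℝ) ≤ n := by exact_mod_cast (card_finset_fin_le A')
  set p := fraction A s with hp
  have hp0 : 0 ≤ p := fraction_nonneg A s
  have hp1 : p ≤ 1 := fraction_le_one A s
  set b : ℝ := 160 / n with hb
  have hb0 : 0 < b := by positivity
  have hb4 : b ≤ 1 / 4 := by rw [hb, div_le_iff₀ hnpos]; linarith
  set q := majorityProb p with hq
  set m : ℝ := (A'.card : ℝ) with hm
  -- `F (r i)` is the new value of server `i`, and `Y i` its centred version.
  set F : (Fin 3 → Fin n) → ℝ := fun w => ((median3 fun j => s (w j)).toNat : ℝ) with hF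
  set P := roundMeasure A with hP
  have hF2 : ∀ w, F w ^ 2 = F w := by
    intro w; simp only [hF]; cases median3 fun j => s (w j) <;> norm_num
  have hEF : ∀ i, ∫ r : Requests n, F (r i) ∂P = q := by
    intro i
    rw [hq, hp, ← integral_median3 A s]
    exact integral_comp_eval (μ := fun _ : Fin n =>
      Measure.pi fun _ : Fin 3 => uniformOn (A : Set (Fin n))) (f := F)
      (measurable_of_finite _).aestronglyMeasurable
  set Y : Fin n → Requests n → ℝ := fun i r => F (r i) - q with hY
  have hq0 : 0 ≤ q := by
    rw [← hEF ⟨0, by omega⟩]; exact integral_nonneg fun r => Nat.cast_nonneg _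
  have hF1 : ∀ w, F w ≤ 1 := fun w => by
    simp only [hF]; exact_mod_cast Bool.toNat_le _
  have hF0 : ∀ w, 0 ≤ F w := fun w => Nat.cast_nonneg _
  have hq1 : q ≤ 1 := by
    rw [← hEF ⟨0, by omega⟩]
    calc _ ≤ ∫ r : Requests n, (1 : ℝ) ∂P := integral_mono .of_finite .of_finite fun r => hF1 _
      _ = 1 := by simp
  have hYI : iIndepFun Y P := iIndepFun_pi (X := fun _ w => F w - q)
    fun i => (measurable_of_finite _).aemeasurable
  have hYb : ∀ i r, |Y i r| ≤ 1 := fun i r => by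
    rw [abs_le]; constructor <;> simp only [hY] <;> linarith [hF0 (r i), hF1 (r i)]
  have hY1 : ∀ i, ∫ r, Y i r ∂P = 0 := fun i => by
    simp only [hY]
    rw [integral_sub .of_finite .of_finite, hEF]
    simp
  have hY2 : ∀ i, ∫ r, Y i r ^ 2 ∂P = q * (1 - q) := fun i => by
    have e : ∀ r, Y i r ^ 2 = (1 - 2 * q) * F (r i) + q ^ 2 := fun r => by
      simp only [hY]; linear_combination hF2 (r i)
    simp_rw [e]
    rw [integral_add .of_finite .of_finite, integral_const_mul, hEF]
    simp
    ring
  obtain ⟨s1, s2, s4⟩ := moments_sum_of_iIndepFun hYI (fun i => measurable_of_finite _) hYb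
    hY1 hY2 A'
  rw [← hm] at s2 s4
  set ξ : Requests n → ℝ := fun r => (∑ i ∈ A', Y i r) / m with hξ
  have hfrac : ∀ r, fraction A' (medianStep s r) = q + ξ r := fun r => by
    simp only [hξ, hY, Finset.sum_sub_distrib, Finset.sum_const, nsmul_eq_mul]
    rw [← hm, sub_div, mul_div_cancel_left₀ _ hm0.ne']
    simp only [fraction, ← hm, medianStep, hF]
    ring
  have e1 : ∫ r, ξ r ∂P = 0 := by
    simp only [hξ]; rw [integral_div, s1, zero_div]
  have e2 : ∫ r, ξ r ^ 2 ∂P = q * (1 - q) / m := by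
    simp only [hξ, div_pow]; rw [integral_div, s2]; field_simp
  have hx4 : q * (1 - q) ≤ 1 / 4 := by nlinarith [sq_nonneg (q - 1 / 2)]
  have hx0 : 0 ≤ q * (1 - q) := mul_nonneg hq0 (by linarith)
  have e4 : ∫ r, ξ r ^ 4 ∂P ≤ 1 / m ^ 2 / 2 := by
    simp only [hξ, div_pow]
    rw [integral_div, div_div, div_le_div_iff₀ (by positivity) (by positivity)]
    have hm1 : 1 ≤ m := by linarith
    have : 3 * m ^ 2 * (q * (1 - q)) ^ 2 + m * (q * (1 - q)) ≤ m ^ 2 / 2 := by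
      have h1 : (q * (1 - q)) ^ 2 ≤ 1 / 16 := by nlinarith
      nlinarith
    nlinarith [mul_le_mul_of_nonneg_right (s4.trans this) (by positivity : 0 ≤ m ^ 2 * 2)]
  simp_rw [hfrac]
  have hφ := potential_nonneg hb0 hp0 hp1
  set r : ℝ := 1 / (m * b) with hr
  have hbr : b * r = 1 / m := by rw [hr]; field_simp
  -- `r = n / (160 * m)` compares the variance of the noise with `b`; it is in `[1 / 160, 1 / 40]`
  -- because `n / 4 ≤ m ≤ n`.
  by_cases hnear : (q - 1 / 2) ^ 2 ≤ b / 3200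
  · refine (integral_potential_le_of_near_half hb0 hb4 hp0 hp1 (r := r) ?_ ?_ hnear .of_finite
      .of_finite .of_finite .of_finite e1 ?_ ?_).trans ?_
    · rw [hr, hb, div_le_div_iff₀ (by norm_num) (by positivity), mul_div_assoc',
        one_mul, div_le_iff₀ hnpos]
      linarith
    · rw [hr, hb, div_le_div_iff₀ (by positivity) (by norm_num), mul_div_assoc',
        one_mul, one_mul, le_div_iff₀ hnpos]
      linarith
    · rw [hbr, e2, mul_one_div]
    · rw [hbr, one_div, inv_pow, ← one_div]; exact e4
    · gcongr; norm_num
  · refine (integral_potential_le_of_variance hb0 hb4 hp0 hp1 .of_finite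
      .of_finite .of_finite e1 ?_).trans ?_
    · rw [e2, div_eq_mul_one_div]
      refine mul_le_mul_of_nonneg_left ?_ hx0
      rw [hb, div_div, div_le_div_iff₀ hm0 (by positivity)]
      linarith
    · refine mul_le_mul_of_nonneg_right ?_ hφ
      -- Off the tie zone the contraction rate is at least `1 / (2 * 3201)`.
      have : 1 / 3201 ≤ ((q - 1 / 2) ^ 2 / ((q - 1 / 2) ^ 2 + b)) := by
        rw [le_div_iff₀ (by positivity)]
        push Not at hnear
        linarith
      linarith

end round

/-! ### Executions with binary values -/

section process

variable {n : ℕ}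

instance isProbabilityMeasure_executionMeasure (U : ℕ → Finset (Fin n)) [∀ t, Nonempty (U t)] :
    IsProbabilityMeasure (executionMeasure U) := by
  unfold executionMeasure; infer_instance

/-- The values at the beginning of round `t` depend only on the choices of the rounds before. -/
theorem measurable_values_past (s₀ : Fin n → Bool) (t : ℕ) :
    Measurable[⨆ k ∈ Set.Iio t, MeasurableSpace.comap
      (fun ω : ℕ → Requests n => ω k) inferInstance] fun ω => values s₀ ω t := by
  induction t with
  | zero => exact @measurable_const _ _ _ _ s₀
  | succ t ih =>
    set m : ℕ → MeasurableSpace (ℕ → Requests n) := fun k =>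
      MeasurableSpace.comap (fun ω : ℕ → Requests n => ω k) inferInstance with hm
    have h1 : Measurable[⨆ k ∈ Set.Iio (t + 1), m k] fun ω => values s₀ ω t :=
      ih.mono (biSup_mono fun k hk => lt_trans hk t.lt_succ_self) le_rfl
    have h2 : Measurable[⨆ k ∈ Set.Iio (t + 1), m k] fun ω : ℕ → Requests n => ω t :=
      (comap_measurable _).mono (le_biSup m t.lt_succ_self) le_rfl
    exact (Measurable.of_discrete (f := fun x : (Fin n → Bool) × Requests n =>
      medianStep x.1 x.2)).comp (h1.prodMk h2)

theorem measurable_values (s₀ : Fin n → Bool) (t : ℕ) :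
    Measurable fun ω : ℕ → Requests n => values s₀ ω t :=
  (measurable_values_past s₀ t).mono
    (iSup₂_le fun k _ => (measurable_pi_apply k).comap_le) le_rfl

theorem indepFun_values (U : ℕ → Finset (Fin n)) [∀ t, Nonempty (U t)] (s₀ : Fin n → Bool)
    (t : ℕ) :
    IndepFun (fun ω => values s₀ ω t) (fun ω => ω t) (executionMeasure U) := by
  have h : iIndepFun (fun k (ω : ℕ → Requests n) => ω k) (executionMeasure U) :=
    iIndepFun_infinitePi (X := fun _ r => r) fun _ => measurable_id
  have h2 := indep_iSup_of_disjoint (fun k => (measurable_pi_apply k).comap_le) h.iIndep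
    (S := Set.Iio t) (T := {t}) (by simp)
  rw [IndepFun_iff_Indep]
  refine indep_of_indep_of_le_left (indep_of_indep_of_le_right h2 ?_)
    (measurable_values_past s₀ t).comap_le
  simp

theorem integral_potential_values_le (hn : 640 ≤ n) (U : ℕ → Finset (Fin n))
    [∀ t, Nonempty (U t)] (hU : ∀ t, (n : ℝ) / 4 ≤ (U t).card) (s₀ : Fin n → Bool) (t : ℕ) :
    ∫ ω, potential (160 / n) (fraction (U t) (values s₀ ω t)) ∂(executionMeasure U)
      ≤ (1 - 1 / 12804) ^ t * n := by
  have hn' : (640 : ℝ) ≤ n := by exact_mod_cast hn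
  have hnpos : (0 : ℝ) < n := by linarith
  set φ : ℕ → (Fin n → Bool) → ℝ := fun t s => potential (160 / n) (fraction (U t) s) with hφ
  change ∫ ω, φ t (values s₀ ω t) ∂(executionMeasure U) ≤ _
  induction t with
  | zero =>
    simp only [values, integral_const, probReal_univ, one_smul, pow_zero, one_mul]
    simp only [hφ, potential]
    set p := fraction (U 0) s₀
    rw [div_le_iff₀ (by positivity), mul_add, mul_div_cancel₀ _ hnpos.ne']
    nlinarith [sq_nonneg (p - 1 / 2), mul_nonneg hnpos.le (sq_nonneg (p - 1 / 2))]
  | succ t ih =>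
    have hlaw : Measure.map (fun ω : ℕ → Requests n => ω t) (executionMeasure U)
        = roundMeasure (U t) := Measure.infinitePi_map_eval _ t
    have hmv := measurable_values s₀ t
    have hmt : Measurable fun ω : ℕ → Requests n => ω t := measurable_pi_apply t
    have hpair := (indepFun_iff_map_prod_eq_prod_map_map hmv.aemeasurable hmt.aemeasurable).mp
      (indepFun_values U s₀ t)
    rw [hlaw] at hpair
    have := Measure.isProbabilityMeasure_map (μ := executionMeasure U) hmv.aemeasurable
    set F : (Fin n → Bool) × Requests n → ℝ := fun x => φ (t + 1) (medianStep x.1 x.2)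
    calc ∫ ω, φ (t + 1) (values s₀ ω (t + 1)) ∂(executionMeasure U)
        = ∫ ω, F (values s₀ ω t, ω t) ∂(executionMeasure U) := rfl
      _ = ∫ x, F x ∂((Measure.map (fun ω => values s₀ ω t) (executionMeasure U)).prod
            (roundMeasure (U t))) := by
          rw [← hpair, integral_map (hmv.prodMk hmt).aemeasurable
            (measurable_of_finite _).aestronglyMeasurable]
      _ = ∫ s, ∫ r, F (s, r) ∂(roundMeasure (U t))
            ∂(Measure.map (fun ω => values s₀ ω t) (executionMeasure U)) :=
          integral_prod _ .of_finite
      _ ≤ ∫ s, (1 - 1 / 12804) * φ t s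
            ∂(Measure.map (fun ω => values s₀ ω t) (executionMeasure U)) :=
          integral_mono .of_finite .of_finite fun s =>
            integral_potential_medianStep_le hn (U t) (U (t + 1)) (hU (t + 1)) s
      _ = (1 - 1 / 12804) * ∫ ω, φ t (values s₀ ω t) ∂(executionMeasure U) := by
          rw [integral_const_mul, integral_map hmv.aemeasurable
            (measurable_of_finite _).aestronglyMeasurable]
      _ ≤ _ := by
          rw [pow_succ', mul_assoc]
          exact mul_le_mul_of_nonneg_left ih (by norm_num)

/-- Without unanimity the potential is at least `1 / n ^ 2`, since a positive fraction is at least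
`1 / n`. -/
theorem one_div_sq_le_potential (hn : 640 ≤ n) (A : Finset (Fin n)) (s : Fin n → Bool)
    {i j : Fin n} (hi : i ∈ A) (hj : j ∈ A) (hs : s i = true) (hs' : s j = false) :
    1 / (n : ℝ) ^ 2 ≤ potential (160 / n) (fraction A s) := by
  have hn' : (640 : ℝ) ≤ n := by exact_mod_cast hn
  have hnpos : (0 : ℝ) < n := by linarith
  have hm : 0 < (A.card : ℝ) := by exact_mod_cast Finset.card_pos.mpr ⟨i, hi⟩
  have hmn : (A.card : ℝ) ≤ n := by exact_mod_cast card_finset_fin_le A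
  have h1 : 1 ≤ ∑ k ∈ A, ((s k).toNat : ℝ) := by
    calc (1 : ℝ) = ((s i).toNat : ℝ) := by simp [hs]
      _ ≤ _ := Finset.single_le_sum (f := fun k => ((s k).toNat : ℝ))
        (fun _ _ => Nat.cast_nonneg _) hi
  have h2 : 1 ≤ A.card - ∑ k ∈ A, ((s k).toNat : ℝ) := by
    calc (1 : ℝ) = 1 - ((s j).toNat : ℝ) := by simp [hs']
      _ ≤ ∑ k ∈ A, (1 - ((s k).toNat : ℝ)) :=
        Finset.single_le_sum (f := fun k => 1 - ((s k).toNat : ℝ))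
          (fun k _ => sub_nonneg.mpr (by exact_mod_cast Bool.toNat_le (s k))) hj
      _ = _ := by simp [Finset.sum_sub_distrib]
  have g1 : 1 / (n : ℝ) ≤ fraction A s := by
    unfold fraction; gcongr
  have g2 : 1 / (n : ℝ) ≤ 1 - fraction A s := by
    calc 1 / (n : ℝ) ≤ (A.card - ∑ k ∈ A, ((s k).toNat : ℝ)) / A.card := by gcongr
      _ = _ := by rw [fraction, sub_div, div_self hm.ne']
  set p := fraction A s
  have hb : (160 : ℝ) / n ≤ 1 / 4 := by rw [div_le_iff₀ hnpos]; linarith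
  have hinv : 0 < 1 / (n : ℝ) := by positivity
  have hden : (p - 1 / 2) ^ 2 + 160 / (n : ℝ) ≤ 1 := by nlinarith
  calc 1 / (n : ℝ) ^ 2 = 1 / n * (1 / n) := by ring
    _ ≤ p * (1 - p) := mul_le_mul g1 g2 hinv.le (hinv.le.trans g1)
    _ ≤ _ := le_div_self (mul_nonneg (hinv.le.trans g1) (hinv.le.trans g2)) (by positivity) hden

theorem measure_not_unanimous_le (hn : 640 ≤ n) (U : ℕ → Finset (Fin n))
    [∀ t, Nonempty (U t)] (hU : ∀ t, (n : ℝ) / 4 ≤ (U t).card) (s₀ : Fin n → Bool) (t : ℕ) :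
    executionMeasure U {ω | ∃ i ∈ U t, ∃ j ∈ U t,
        values s₀ ω t i = true ∧ values s₀ ω t j = false}
      ≤ ENNReal.ofReal ((1 - 1 / 12804) ^ t * n ^ 3) := by
  have hnpos : (0 : ℝ) < n := by exact_mod_cast (by omega : 0 < n)
  have hm : Measurable fun ω : ℕ → Requests n =>
      potential (160 / n) (fraction (U t) (values s₀ ω t)) :=
    (measurable_of_finite fun s => potential (160 / n) (fraction (U t) s)).comp
      (measurable_values s₀ t)
  have hnn : ∀ s, 0 ≤ potential (160 / n) (fraction (U t) s) := fun s =>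
    potential_nonneg (by positivity) (fraction_nonneg _ _) (fraction_le_one _ _)
  have hint : Integrable (fun ω => potential (160 / n) (fraction (U t) (values s₀ ω t)))
      (executionMeasure U) := by
    have := Measure.isProbabilityMeasure_map (μ := executionMeasure U)
      (measurable_values s₀ t).aemeasurable
    exact (Integrable.of_finite (f := fun s => potential (160 / n) (fraction (U t) s))
      (μ := Measure.map (fun ω => values s₀ ω t) (executionMeasure U))).comp_measurable
      (measurable_values s₀ t)
  have hmarkov := (mul_meas_ge_le_integral_of_nonneg (.of_forall fun ω => hnn _) hint
    (1 / (n : ℝ) ^ 2)).trans (integral_potential_values_le hn U hU s₀ t)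
  calc _ ≤ executionMeasure U {ω | 1 / (n : ℝ) ^ 2 ≤
        potential (160 / n) (fraction (U t) (values s₀ ω t))} := by
        refine measure_mono fun ω => ?_
        rintro ⟨i, hi, j, hj, h1, h2⟩
        exact one_div_sq_le_potential hn (U t) _ hi hj h1 h2
    _ = ENNReal.ofReal ((executionMeasure U).real {ω | 1 / (n : ℝ) ^ 2 ≤
        potential (160 / n) (fraction (U t) (values s₀ ω t))}) := (ofReal_measureReal).symm
    _ ≤ _ := by
        apply ENNReal.ofReal_le_ofReal
        rw [one_div_mul_eq_div, div_le_iff₀ (by positivity)] at hmarkov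
        linarith

end process

/-! ### Thresholds -/

section threshold

variable {K : Type*} [LinearOrder K] {n : ℕ}

/-- A monotone map commutes with medians, because it keeps a sorted triple sorted. -/
theorem map_median3 {L : Type*} [LinearOrder L] {f : K → L} (hf : Monotone f) (w : Fin 3 → K) :
    median3 (fun j => f (w j)) = f (median3 w) := by
  have h : Monotone ((f ∘ w) ∘ Tuple.sort w) := hf.comp (Tuple.monotone_sort w)
  exact congrFun (Tuple.comp_sort_eq_comp_iff_monotone.mpr h).symm 1

theorem values_comp_monotone {L : Type*} [LinearOrder L] {f : K → L} (hf : Monotone f)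
    (x₀ : Fin n → K) (ω : ℕ → Requests n) (t : ℕ) (i : Fin n) :
    values (f ∘ x₀) ω t i = f (values x₀ ω t i) := by
  induction t generalizing i with
  | zero => rfl
  | succ t ih =>
    simp only [values, ih]
    exact map_median3 hf _

theorem exists_values_eq (x₀ : Fin n → K) (ω : ℕ → Requests n) (t : ℕ) (i : Fin n) :
    ∃ k, values x₀ ω t i = x₀ k := by
  induction t generalizing i with
  | zero => exact ⟨i, rfl⟩
  | succ t ih => exact ih _

theorem values_eq_of_unanimous {U : ℕ → Finset (Fin n)} {x₀ : Fin n → K} {ω : ℕ → Requests n}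
    (hω : ∀ t i j, ω t i j ∈ U t) {T : ℕ} {v : K} (h : ∀ i ∈ U T, values x₀ ω T i = v) {t : ℕ}
    (ht : T ≤ t) : ∀ i ∈ U t, values x₀ ω t i = v := by
  induction t, ht using Nat.le_induction with
  | base => exact h
  | succ t _ ih => exact fun i _ => ih _ (hω t i _)

/-- Requests outside of the useful servers are possible outcomes of probability zero. -/
theorem ae_requests_mem (U : ℕ → Finset (Fin n)) [∀ t, Nonempty (U t)] :
    ∀ᵐ ω ∂(executionMeasure U), ∀ t i j, ω t i j ∈ U t := by
  simp_rw [ae_all_iff]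
  intro t i j
  have h₀ : ∀ᵐ k ∂(uniformOn (U t : Set (Fin n))), k ∈ U t := by
    have := ae_cond_mem (μ := Measure.count) (U t).measurableSet
    simpa [uniformOn] using this
  have h₁ : ∀ᵐ w ∂(Measure.pi fun _ : Fin 3 => uniformOn (U t : Set (Fin n))), w j ∈ U t :=
    (measurePreserving_eval (fun _ : Fin 3 => uniformOn (U t : Set (Fin n)))
      j).quasiMeasurePreserving.ae h₀
  have h₂ : ∀ᵐ r ∂(roundMeasure (U t)), r i j ∈ U t :=
    (measurePreserving_eval (fun _ : Fin n => Measure.pi fun _ : Fin 3 =>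
      uniformOn (U t : Set (Fin n))) i).quasiMeasurePreserving.ae h₁
  exact (measurePreserving_eval_infinitePi (fun t => roundMeasure (U t)) t).quasiMeasurePreserving.ae h₂

/-- If agreement fails, then in the first round that counts the useful servers are on both sides of
some initial value. -/
theorem exists_threshold_of_not_agreement {U : ℕ → Finset (Fin n)} [∀ t, Nonempty (U t)]
    {x₀ : Fin n → K} {ω : ℕ → Requests n} (hω : ∀ t i j, ω t i j ∈ U t) {τ : ℝ}
    (h : ¬ AgreementWithin U x₀ τ ω) :
    ∃ k, ∃ i ∈ U ⌈τ⌉₊, ∃ j ∈ U ⌈τ⌉₊,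
      values ((fun x => decide (x₀ k < x)) ∘ x₀) ω ⌈τ⌉₊ i = true ∧
      values ((fun x => decide (x₀ k < x)) ∘ x₀) ω ⌈τ⌉₊ j = false := by
  by_contra! hcon
  apply h
  obtain ⟨i₀, hi₀⟩ := Finset.nonempty_coe_sort.mp (inferInstance : Nonempty (U ⌈τ⌉₊))
  have hmono : ∀ k, Monotone fun x : K => decide (x₀ k < x) := fun k x y hxy => by
    by_cases hx : x₀ k < x
    · simp [hx, hx.trans_le hxy]
    · simp [hx]
  -- Two distinct values are separated by the threshold at the smaller one.
  have hle : ∀ i ∈ U ⌈τ⌉₊, ∀ j ∈ U ⌈τ⌉₊, values x₀ ω ⌈τ⌉₊ i ≤ values x₀ ω ⌈τ⌉₊ j := by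
    intro i hi j hj
    by_contra! hlt
    obtain ⟨k, hk⟩ := exists_values_eq x₀ ω ⌈τ⌉₊ j
    refine hcon k i hi j hj ?_ ?_
    · rw [values_comp_monotone (hmono k), ← hk]; simpa using hlt
    · rw [values_comp_monotone (hmono k), ← hk]; simp
  exact ⟨values x₀ ω ⌈τ⌉₊ i₀, fun t ht => values_eq_of_unanimous hω
    (fun i hi => (hle i hi i₀ hi₀).antisymm (hle i₀ hi₀ i hi)) (Nat.ceil_le.mpr ht)⟩

end threshold

/-! ### Agreement in logarithmic time -/

theorem pow_mul_pow_le_one_div_rpow {n T : ℕ} (hn : 1 ≤ n) {c : ℝ}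
    (hT : 12804 * (c + 4) * Real.log n ≤ T) :
    n * ((1 - 1 / 12804) ^ T * (n : ℝ) ^ 3) ≤ 1 / (n : ℝ) ^ c := by
  have hnpos : (0 : ℝ) < n := by exact_mod_cast hn
  have h1 : (1 - 1 / 12804 : ℝ) ^ T ≤ Real.exp (-(c + 4) * Real.log n) := by
    calc (1 - 1 / 12804 : ℝ) ^ T ≤ Real.exp (-(1 / 12804)) ^ T :=
          pow_le_pow_left₀ (by norm_num) (Real.one_sub_le_exp_neg _) T
      _ = Real.exp (-(1 / 12804) * T) := by rw [← Real.exp_nat_mul, mul_comm]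
      _ ≤ _ := Real.exp_le_exp.mpr (by linarith)
  calc (n : ℝ) * ((1 - 1 / 12804) ^ T * (n : ℝ) ^ 3) = (1 - 1 / 12804) ^ T * (n : ℝ) ^ 4 := by ring
    _ ≤ Real.exp (-(c + 4) * Real.log n) * (n : ℝ) ^ 4 := by gcongr
    _ = (n : ℝ) ^ (-c) := by
        rw [mul_comm (-(c + 4)), ← Real.rpow_def_of_pos hnpos, ← Real.rpow_natCast,
          ← Real.rpow_add hnpos]
        norm_num
    _ = _ := by rw [Real.rpow_neg hnpos.le, one_div]

theorem mainTheorem5 :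
    ∀ c : ℝ, 0 < c → ∃ (C : ℝ) (n₀ : ℕ), ∀ n : ℕ, n₀ ≤ n →
      ∀ (K : Type*) [LinearOrder K] (U : ℕ → Finset (Fin n)),
        (∀ t, (n : ℝ) / 4 ≤ ((U t).card : ℝ) ∧ (U t).card ≤ n) →
        ∀ x₀ : Fin n → K,
          executionMeasure U {ω | ¬ AgreementWithin U x₀ (C * Real.log n) ω}
            ≤ ENNReal.ofReal (1 / (n : ℝ) ^ c) := by
  intro c _
  refine ⟨12804 * (c + 4), 640, fun n hn K _ U hU x₀ => ?_⟩
  have hnpos : (0 : ℝ) < n := by exact_mod_cast (by omega : 0 < n)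
  have hne : ∀ t, Nonempty (U t) := fun t => Finset.nonempty_coe_sort.mpr <|
    Finset.card_pos.mp <| by
      have := (hU t).1
      exact_mod_cast (by linarith : (0 : ℝ) < (U t).card)
  set τ := 12804 * (c + 4) * Real.log n
  set T := ⌈τ⌉₊
  set E : Fin n → Set (ℕ → Requests n) := fun k => {ω | ∃ i ∈ U T, ∃ j ∈ U T,
    values ((fun x => decide (x₀ k < x)) ∘ x₀) ω T i = true ∧
    values ((fun x => decide (x₀ k < x)) ∘ x₀) ω T j = false}
  calc executionMeasure U {ω | ¬ AgreementWithin U x₀ τ ω}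
      ≤ executionMeasure U (⋃ k, E k) := by
        refine measure_mono_ae ?_
        filter_upwards [ae_requests_mem U] with ω hω h
        exact Set.mem_iUnion.mpr (exists_threshold_of_not_agreement hω h)
    _ ≤ ∑ k, executionMeasure U (E k) := measure_iUnion_fintype_le _ _
    _ ≤ ∑ _k : Fin n, ENNReal.ofReal ((1 - 1 / 12804) ^ T * n ^ 3) :=
        Finset.sum_le_sum fun k _ => measure_not_unanimous_le hn U (fun t => (hU t).1) _ T
    _ = ENNReal.ofReal (n * ((1 - 1 / 12804) ^ T * n ^ 3)) := by
        rw [Finset.sum_const, Finset.card_univ, Fintype.card_fin, nsmul_eq_mul,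
          ENNReal.ofReal_mul hnpos.le, ENNReal.ofReal_natCast]
    _ ≤ _ := ENNReal.ofReal_le_ofReal
        (pow_mul_pow_le_one_div_rpow (by omega) (Nat.le_ceil τ))
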